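/- Work over $\mathbb{C}$. Let $X\subset\mathbb{P}^r$ be an irreducible, non-degenerate projective variety of dimension $m$ (non-degenerate: its linear span is $\mathbb{P}^r$). For a smooth point $P$ of $X$ let $T_{X,P}$ be the embedded tangent space to $X$ at $P$. A hyperplane $H$ is tangent to $X$ at a smooth point $P$ if $T_{X,P}\subset H$. For an integer $k\ge 0$ with $km+m+k<r$ (so that the closure of the union of the $k$-spaces spanned by $k+1$ independent points of $X$ is not $\mathbb{P}^r$), $X$ is called $k$-weakly defective if, for general points $P_0,\dots,P_k\in X$, the general hyperplane $H$ containing $T_{X,P_0},\dots,T_{X,P_k}$ has a contact variety of positive dimension, that is, $H$ is tangent to $X$ along a positive-dimensional irreducible closed subvariety $Z\subset X$ passing through one of the points $P_i$ (meaning that $H$ is tangent to $X$ at every point of $Z$ that is smooth on $X$). Let $k\ge 1$ be an integer with $km+m+k<r$, and assume that $X$ is not $k$-weakly defective. Then $X$ is not $(k-1)$-weakly defective. Consequently, $X$ is not $j$-weakly defective for any integer $0\le j\le k$. -/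

import Mathlib

open scoped LinearAlgebra.Projectivization

namespace WeakDefect

/-- The complex projective space of dimension `r`. -/
abbrev PSpace (r : ℕ) : Type := ℙ ℂ (Fin (r + 1) → ℂ)

/-- The common zeros in projective space of a set of (homogeneous) polynomials. -/
def zeroSet {r : ℕ} (S : Set (MvPolynomial (Fin (r + 1)) ℂ)) : Set (PSpace r) :=
  {P | ∀ f ∈ S, MvPolynomial.eval P.rep f = 0}

/-- Algebraic subsets: zero sets of families of homogeneous polynomials. -/
def algebraicSets (r : ℕ) : Set (Set (PSpace r)) :=
  {Z | ∃ S : Set (MvPolynomial (Fin (r + 1)) ℂ),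
    (∀ f ∈ S, ∃ d : ℕ, f.IsHomogeneous d) ∧ Z = zeroSet S}

/-- The Zariski topology on projective space. -/
instance zariski (r : ℕ) : TopologicalSpace (PSpace r) :=
  TopologicalSpace.ofClosed (algebraicSets r)
    (by
      refine ⟨{1}, ?_, ?_⟩
      · rintro f rfl
        exact ⟨0, MvPolynomial.isHomogeneous_one _ _⟩
      · ext P
        simp [zeroSet])
    (by
      intro A hA
      have hA' : ∀ Z, ∃ S : Set (MvPolynomial (Fin (r + 1)) ℂ), Z ∈ A →
          (∀ f ∈ S, ∃ d : ℕ, f.IsHomogeneous d) ∧ Z = zeroSet S := by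
        intro Z
        by_cases hZ : Z ∈ A
        · obtain ⟨S, hS⟩ := hA hZ
          exact ⟨S, fun _ => hS⟩
        · exact ⟨∅, fun h => absurd h hZ⟩
      choose S hS using hA'
      refine ⟨⋃ Z ∈ A, S Z, ?_, ?_⟩
      · intro f hf
        simp only [Set.mem_iUnion] at hf
        obtain ⟨Z, hZ, hf⟩ := hf
        exact (hS Z hZ).1 f hf
      · ext P
        simp only [Set.mem_sInter, zeroSet, Set.mem_iUnion, Set.mem_ofPred_eq]
        constructor
        · rintro h f ⟨Z, hZ, hf⟩
          have h1 := h Z hZ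
          rw [(hS Z hZ).2] at h1
          exact h1 f hf
        · intro h Z hZ
          rw [(hS Z hZ).2]
          exact fun f hf => h f ⟨Z, hZ, hf⟩)
    (by
      rintro _ ⟨S, hS, rfl⟩ _ ⟨T, hT, rfl⟩
      refine ⟨{p | ∃ f ∈ S, ∃ g ∈ T, p = f * g}, ?_, ?_⟩
      · rintro _ ⟨f, hf, g, hg, rfl⟩
        obtain ⟨d, hd⟩ := hS f hf
        obtain ⟨e, he⟩ := hT g hg
        exact ⟨d + e, hd.mul he⟩
      · ext P
        constructor
        · rintro (h | h) _ ⟨f, hf, g, hg, rfl⟩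
          · rw [map_mul, h f hf, zero_mul]
          · rw [map_mul, h g hg, mul_zero]
        · intro h
          by_contra hc
          simp only [Set.mem_union, not_or, zeroSet, Set.mem_ofPred_eq, not_forall] at hc
          obtain ⟨⟨f, hf, hf0⟩, ⟨g, hg, hg0⟩⟩ := hc
          have h1 := h (f * g) ⟨f, hf, g, hg, rfl⟩
          rw [map_mul] at h1
          exact (mul_ne_zero hf0 hg0) h1)

/-- Polynomials in `n` groups of `r + 1` variables that are homogeneous, of degree `d i`, in the
`i`-th group of variables for every `i`. -/
def IsMultihomogeneous {n r : ℕ} (f : MvPolynomial (Fin n × Fin (r + 1)) ℂ)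
    (d : Fin n → ℕ) : Prop :=
  MvPolynomial.IsWeightedHomogeneous
    (fun ij : Fin n × Fin (r + 1) => (Pi.single ij.1 1 : Fin n → ℕ)) f d

/-- Zariski open subsets of the product of `n` copies of projective space: complements of zero sets
of families of multihomogeneous polynomials. -/
def IsZariskiOpen {n r : ℕ} (U : Set (Fin n → PSpace r)) : Prop :=
  ∃ S : Set (MvPolynomial (Fin n × Fin (r + 1)) ℂ),
    (∀ f ∈ S, ∃ d : Fin n → ℕ, IsMultihomogeneous f d) ∧
    U = {P | ∃ f ∈ S, MvPolynomial.eval (fun ij => (P ij.1).rep ij.2) f ≠ 0}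

/-- The linear span of a subset of projective space, as a vector subspace of `ℂ ^ (r + 1)`. -/
noncomputable def linearSpan {r : ℕ} (Y : Set (PSpace r)) : Submodule ℂ (Fin (r + 1) → ℂ) :=
  ⨆ P ∈ Y, P.submodule

/-- An irreducible, non-degenerate projective variety of dimension `m` in projective space of
dimension `r`. -/
structure IsNondegenerateVariety {r : ℕ} (X : Set (PSpace r)) (m : ℕ) : Prop where
  isClosed : IsClosed X
  isIrreducible : IsIrreducible X
  dim_eq : topologicalKrullDim X = m
  span_eq : linearSpan X = ⊤

/-- The embedded tangent space to `X` at `P`, as a vector subspace of `ℂ ^ (r + 1)`: the common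
kernel of the differentials at `P` of the homogeneous polynomials vanishing on `X`. -/
noncomputable def tangentSpace {r : ℕ} (X : Set (PSpace r)) (P : PSpace r) :
    Submodule ℂ (Fin (r + 1) → ℂ) where
  carrier := {v | ∀ f : MvPolynomial (Fin (r + 1)) ℂ, (∃ d : ℕ, f.IsHomogeneous d) →
    (∀ Q ∈ X, MvPolynomial.eval Q.rep f = 0) →
    ∑ j, MvPolynomial.eval P.rep (MvPolynomial.pderiv j f) * v j = 0}
  add_mem' := by
    intro v w hv hw f hf hX
    simp only [Pi.add_apply, mul_add, Finset.sum_add_distrib]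
    rw [hv f hf hX, hw f hf hX, add_zero]
  zero_mem' := by
    intro f _ _
    simp
  smul_mem' := by
    intro c v hv f hf hX
    simp only [Pi.smul_apply, smul_eq_mul, mul_left_comm _ c, ← Finset.mul_sum]
    rw [hv f hf hX, mul_zero]

/-- The smooth points of an irreducible variety `X`: those where the (projective) dimension of the
embedded tangent space is the dimension of `X`. -/
def smoothLocus {r : ℕ} (X : Set (PSpace r)) : Set (PSpace r) :=
  {P | P ∈ X ∧
    ((Module.finrank ℂ (tangentSpace X P) : ℕ) : WithBot ℕ∞) = topologicalKrullDim X + 1}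

/-- The span of the tangent spaces to `X` at the points `P i`. -/
noncomputable def tangentSpan {r n : ℕ} (X : Set (PSpace r)) (P : Fin n → PSpace r) :
    Submodule ℂ (Fin (r + 1) → ℂ) :=
  ⨆ i, tangentSpace X (P i)

/-- The hyperplane with coordinates `h` in the dual projective space. -/
noncomputable def hyperplane {r : ℕ} (h : PSpace r) : Submodule ℂ (Fin (r + 1) → ℂ) where
  carrier := {v | ∑ j, h.rep j * v j = 0}
  add_mem' := by
    intro v w hv hw
    simp only [Set.mem_ofPred_eq] at hv hw
    simp [mul_add, Finset.sum_add_distrib, hv, hw]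
  zero_mem' := by simp
  smul_mem' := by
    intro c v hv
    simp only [Set.mem_ofPred_eq] at hv
    simp [mul_left_comm _ c, ← Finset.mul_sum, hv]

/-- The contact variety of the hyperplane `h` at the points `P i` has positive dimension: `h` is
tangent to `X` along an irreducible closed subvariety `Z` of positive dimension that passes through
one of the points `P i` (tangency being required at the points of `Z` that are smooth on `X`). -/
def HasPositiveDimContact {r n : ℕ} (X : Set (PSpace r)) (P : Fin n → PSpace r)
    (h : PSpace r) : Prop :=
  ∃ Z : Set (PSpace r), IsClosed Z ∧ IsIrreducible Z ∧ Z ⊆ X ∧ (∃ i, P i ∈ Z) ∧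
    0 < topologicalKrullDim Z ∧
    ∀ Q ∈ Z, Q ∈ smoothLocus X → tangentSpace X Q ≤ hyperplane h

/-- `X` is `k`-weakly defective: for `k + 1` general points of `X` (a nonempty Zariski open set of
`(k + 1)`-tuples of smooth points), the general hyperplane containing the tangent spaces to `X` at
these points (a nonempty Zariski open set of the linear system of such hyperplanes) has a contact
variety of positive dimension. The notion is meant for those `k` for which the `k`-secant variety
is not the whole space, e.g. if `k * m + m + k < r` with `m` the dimension of `X`. -/
def IsWeaklyDefective {r : ℕ} (X : Set (PSpace r)) (k : ℕ) : Prop :=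
  ∃ U : Set (Fin (k + 1) → PSpace r), IsZariskiOpen U ∧
    (∃ P ∈ U, ∀ i, P i ∈ smoothLocus X) ∧
    ∀ P ∈ U, (∀ i, P i ∈ smoothLocus X) →
      ∃ V : Set (PSpace r), IsOpen V ∧
        (∃ h ∈ V, tangentSpan X P ≤ hyperplane h) ∧
        ∀ h ∈ V, tangentSpan X P ≤ hyperplane h → HasPositiveDimContact X P h

end WeakDefect

/-!
Let `X` be `j`-weakly defective and let `P₀, …, P_{j+1}` be general smooth points of `X`. A
hyperplane `h₀` tangent at all of them is tangent at `P₀, …, P_j`; join it to a general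
hyperplane `h₁` tangent at these points by the pencil `h₀ + t • (h₁ - h₀)`. Infinitely many
members of the pencil are general, so that for some `i ≤ j` infinitely many of them have contact
of positive dimension through `Pᵢ`. The points where `h₀ + t • (h₁ - h₀)` is tangent to `X` are
cut out, near `Pᵢ`, by determinantal equations which are linear in `t`. If the contact at `t = 0`
were isolated, that is, if the ideal of `Pᵢ` were minimal over the ideal of these equations, it
would be so for all but finitely many `t`, by Krull's height theorem. Hence `h₀` itself has
contact of positive dimension, and `h₀` exists because the span of the `j + 2` tangent spaces has
dimension at most `(j + 2) * (m + 1) ≤ r`.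
-/

namespace WeakDefect

attribute [local instance] MvPolynomial.gradedAlgebra

section CommutativeAlgebra

open Polynomial

theorem exists_notMem_forall_mul_mem_radical {R : Type*} [CommRing R] [IsNoetherianRing R]
    {J p : Ideal R} (hp : p ∈ J.minimalPrimes) : ∃ y ∉ p, ∀ x ∈ p, y * x ∈ J.radical := by
  have hprime : p.IsPrime := hp.isPrime
  have hfin : (J.minimalPrimes \ {p}).Finite :=
    (Ideal.finite_minimalPrimes_of_isNoetherianRing R J).subset Set.sdiff_subset
  have hnot : ¬ hfin.toFinset.inf id ≤ p := by
    rw [hprime.inf_le']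
    rintro ⟨q, hq, hqp⟩
    rw [Set.Finite.mem_toFinset] at hq
    exact hq.2 (hqp.antisymm (hp.2 hq.1.1 hqp))
  obtain ⟨y, hy, hyp⟩ := SetLike.not_le_iff_exists.1 hnot
  refine ⟨y, hyp, fun x hx => ?_⟩
  rw [← Ideal.sInf_minimalPrimes, Ideal.mem_sInf]
  intro q hq
  by_cases hqp : q = p
  · exact hqp ▸ p.mul_mem_left y hx
  · exact q.mul_mem_right x
      (Finset.inf_le (f := id) (hfin.mem_toFinset.2 ⟨hq, hqp⟩) hy)

/- Krull's principal ideal theorem: the pullback of `p` to `R[X]` is minimal over `J + (X - a)` and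
strictly contains `p R[X]`. -/
theorem map_C_mem_minimalPrimes {R : Type*} [CommRing R] [IsNoetherianRing R] {J : Ideal R[X]}
    {p : Ideal R} (hJ : J ≤ p.map C) {a : R} (hp : p ∈ (J.map (evalRingHom a)).minimalPrimes) :
    p.map C ∈ J.minimalPrimes := by
  have hprime : p.IsPrime := hp.isPrime
  have hsurj : Function.Surjective (evalRingHom a) := fun b => ⟨C b, eval_C⟩
  have hspan : (J.map (evalRingHom a)).comap (evalRingHom a) =
      Ideal.span (insert (X - C a) (J : Set R[X])) := by
    rw [Ideal.comap_map_of_surjective _ hsurj, Ideal.span_insert, Ideal.span_eq, sup_comm,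
      ← RingHom.ker_eq_comap_bot, ker_evalRingHom]
  have hmin : p.comap (evalRingHom a) ∈
      (Ideal.span (insert (X - C a) (J : Set R[X]))).minimalPrimes := by
    rw [← hspan, Ideal.comap_minimalPrimes_eq_of_surjective hsurj]
    exact ⟨p, hp, rfl⟩
  have hle : p.map C ≤ p.comap (evalRingHom a) := by
    rw [Ideal.map_le_iff_le_comap]
    intro b hb
    simpa using hb
  have hX : X - C a ∉ p.map C := fun h => by
    refine hprime.ne_top ((Ideal.eq_top_iff_one p).2 ?_)
    simpa using Ideal.mem_map_C_iff.1 h 1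
  have hlt : p.map C < p.comap (evalRingHom a) :=
    hle.lt_of_not_ge fun h => hX (h (by simp))
  simpa using Ideal.mem_minimalPrimes_span_of_mem_minimalPrimes_span_insert hlt (X - C a)
    (J : Set R[X]) hmin (J : Set R[X]) hJ
    (((Set.subset_insert _ _).trans Ideal.subset_span).trans Ideal.le_radical)

variable {k R : Type*} [Field k] [CommRing R] [Algebra k R]

theorem finite_eval_algebraMap_mem {p : Ideal R} [p.IsPrime] {f : R[X]} (hf : f ∉ p.map C) :
    {t : k | f.eval (algebraMap k R t) ∈ p}.Finite := by
  have hne : f.map (Ideal.Quotient.mk p) ≠ 0 := fun h => hf <| Ideal.mem_map_C_iff.2 fun n => by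
    rw [← Ideal.Quotient.eq_zero_iff_mem, ← coeff_map, h, coeff_zero]
  refine ((finite_setOfPred_isRoot hne).preimage
    (algebraMap k (R ⧸ p)).injective.injOn).subset fun t ht => ?_
  rwa [Set.mem_preimage, Set.mem_ofPred_eq, IsRoot.def,
    IsScalarTower.algebraMap_apply k R (R ⧸ p), Ideal.Quotient.algebraMap_eq, eval_map_apply,
    Ideal.Quotient.eq_zero_iff_mem]

theorem finite_notMem_minimalPrimes_map_evalRingHom_of_map_C_mem [IsNoetherianRing R]
    {J : Ideal R[X]} {p : Ideal R} (hp : p.map C ∈ J.minimalPrimes) :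
    {t : k | p ∉ (J.map (evalRingHom (algebraMap k R t))).minimalPrimes}.Finite := by
  have hprime : p.IsPrime := Ideal.isPrime_map_C_iff_isPrime _ |>.1 hp.isPrime
  obtain ⟨f, hfp, hf⟩ := exists_notMem_forall_mul_mem_radical hp
  refine (finite_eval_algebraMap_mem hfp).subset fun t ht => ?_
  by_contra hft
  refine ht ⟨⟨hprime, ?_⟩, fun q ⟨hq, hJq⟩ hqp x hx => ?_⟩
  · rw [Ideal.map_le_iff_le_comap]
    refine hp.1.2.trans (Ideal.map_le_iff_le_comap.2 fun x hx => ?_)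
    simpa using hx
  · have hmem : (f * C x).eval (algebraMap k R t) ∈ q :=
      hq.radical_le_iff.2 hJq
        (Ideal.map_radical_le _ (Ideal.mem_map_of_mem _ (hf _ (Ideal.mem_map_of_mem C hx))))
    rw [eval_mul, eval_C] at hmem
    exact (hq.mem_or_mem hmem).resolve_left fun h => hft (hqp h)

/-- Being isolated in the fibres of a one-parameter family is an open condition. -/
theorem finite_notMem_minimalPrimes_map_evalRingHom [IsNoetherianRing R] {J : Ideal R[X]}
    {p : Ideal R} (hJ : J ≤ p.map C) {a : R} (hp : p ∈ (J.map (evalRingHom a)).minimalPrimes) :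
    {t : k | p ∉ (J.map (evalRingHom (algebraMap k R t))).minimalPrimes}.Finite :=
  finite_notMem_minimalPrimes_map_evalRingHom_of_map_C_mem (map_C_mem_minimalPrimes hJ hp)

theorem height_le_card_of_le_span_sup_sq {R : Type*} [CommRing R] [IsNoetherianRing R]
    {M : Ideal R} [M.IsPrime] {s : Finset R} (hsM : (s : Set R) ⊆ M)
    (h : M ≤ Ideal.span s ⊔ M ^ 2) : M.height ≤ s.card := by
  obtain ⟨b, hb, hbM⟩ := Submodule.exists_sub_one_mem_and_smul_le_of_fg_of_le_sup
    (I := M) (N := Ideal.span (s : Set R)) (IsNoetherian.noetherian M) le_rfl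
    (by rwa [smul_eq_mul, ← pow_two])
  refine Ideal.height_le_card_of_mem_minimalPrimes_span_finset
    ⟨⟨inferInstance, Ideal.span_le.2 hsM⟩, fun q ⟨hq, hsq⟩ hqM x hx => ?_⟩
  have hbq : b ∉ q := fun hbq => by
    refine Ideal.IsPrime.ne_top ‹M.IsPrime› ((Ideal.eq_top_iff_one M).2 ?_)
    simpa using M.sub_mem (hqM hbq) hb
  have hbx : b * x ∈ Ideal.span (s : Set R) := hbM (Submodule.smul_mem_pointwise_smul x b _ hx)
  exact (hq.mem_or_mem (hsq hbx)).resolve_left hbq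

theorem height_of_isMaximal_mvPolynomial {k : Type*} [Field k] (n : ℕ)
    (M : Ideal (MvPolynomial (Fin n) k)) [hM : M.IsMaximal] : M.height = n := by
  induction n with
  | zero =>
    have hle : (M.height : WithBot ℕ∞) ≤ ringKrullDim (MvPolynomial (Fin 0) k) :=
      Ideal.height_le_ringKrullDim_of_ne_top hM.ne_top
    simpa using hle
  | succ n ih =>
    let e := (MvPolynomial.finSuccEquiv k n).toRingEquiv
    let N := (M.map e).comap (C : MvPolynomial (Fin n) k →+* _)
    have : (M.map e).IsMaximal := Ideal.map_isMaximal_of_equiv e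
    have : N.IsMaximal := isMaximal_comap_C_of_isJacobsonRing _
    have : (M.map e).LiesOver N := ⟨rfl⟩
    rw [← e.height_map M, height_eq_height_add_one N (M.map e), ih, Nat.cast_add, Nat.cast_one]

theorem ringKrullDim_le_height_of_isMaximal (k : Type*) {A : Type*} [Field k] [CommRing A]
    [IsDomain A] [Algebra k A] [Algebra.FiniteType k A] (M : Ideal A) [M.IsMaximal] :
    ringKrullDim A ≤ M.height := by
  obtain ⟨n, g, hinj, hint⟩ := exists_integral_inj_algHom_of_fg k A
  algebraize [g.toRingHom]
  have : FaithfulSMul (MvPolynomial (Fin n) k) A :=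
    (faithfulSMul_iff_algebraMap_injective _ _).2 hinj
  have : Algebra.IsIntegral (MvPolynomial (Fin n) k) A := ⟨hint⟩
  have : IsNoetherianRing A := Algebra.FiniteType.isNoetherianRing k A
  have : (M.under (MvPolynomial (Fin n) k)).IsMaximal :=
    Ideal.isMaximal_comap_of_isIntegral_of_isMaximal M
  have hdim : ringKrullDim A ≤ ringKrullDim (MvPolynomial (Fin n) k) :=
    Order.krullDim_le_of_strictMono (PrimeSpectrum.comap (algebraMap _ A))
      fun I J hIJ => Ideal.IsIntegral.comap_lt_comap hIJ
  have hheight : (n : ℕ∞) ≤ M.height := by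
    rw [Ideal.height_eq_height_add_of_liesOver_of_hasGoingDown
      (M.under (MvPolynomial (Fin n) k)) M, height_of_isMaximal_mvPolynomial]
    exact le_self_add
  calc ringKrullDim A ≤ ringKrullDim (MvPolynomial (Fin n) k) := hdim
    _ = ((n : ℕ∞) : WithBot ℕ∞) := by simp
    _ ≤ M.height := WithBot.coe_le_coe.2 hheight

end CommutativeAlgebra

section Homogeneous

open MvPolynomial

theorem eval_smul_of_isHomogeneous {σ R : Type*} [CommSemiring R] {f : MvPolynomial σ R} {d : ℕ}
    (hf : f.IsHomogeneous d) (c : R) (x : σ → R) : eval (c • x) f = c ^ d * eval x f := by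
  rw [eval_eq, eval_eq, Finset.mul_sum]
  refine Finset.sum_congr rfl fun u hu => ?_
  have hd : ∑ i ∈ u.support, u i = d := by
    simpa [Finsupp.degree, Finsupp.weight_apply, Finsupp.sum] using hf (mem_support_iff.1 hu)
  simp only [Pi.smul_apply, smul_eq_mul, mul_pow, Finset.prod_mul_distrib,
    Finset.prod_pow_eq_pow_sum, hd]
  ring

theorem eval_homogeneousComponent_eq_zero {σ K : Type*} [CommRing K] [IsDomain K] [Infinite K]
    {f : MvPolynomial σ K} {x : σ → K} (h : ∀ c : K, eval (c • x) f = 0) (d : ℕ) :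
    eval x (homogeneousComponent d f) = 0 := by
  by_cases hd : f.totalDegree < d
  · rw [homogeneousComponent_eq_zero _ _ hd, map_zero]
  let p : Polynomial K := ∑ i ∈ Finset.range (f.totalDegree + 1),
    Polynomial.C (eval x (homogeneousComponent i f)) * Polynomial.X ^ i
  have hp : p = 0 := Polynomial.funext fun c => by
    conv_rhs => rw [Polynomial.eval_zero, ← h c, ← sum_homogeneousComponent f, map_sum]
    rw [Polynomial.eval_finsetSum]
    refine Finset.sum_congr rfl fun i _ => ?_
    rw [eval_smul_of_isHomogeneous (homogeneousComponent_isHomogeneous i f), Polynomial.eval_mul,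
      Polynomial.eval_C, Polynomial.eval_pow, Polynomial.eval_X, mul_comm]
  have hcoeff : p.coeff d = 0 := by rw [hp, Polynomial.coeff_zero]
  simpa [p, Nat.lt_succ_iff, not_lt.1 hd] using hcoeff

theorem isHomogeneous_of_homogeneousComponent_mem {σ R : Type*} [CommSemiring R]
    {I : Ideal (MvPolynomial σ R)} (h : ∀ f ∈ I, ∀ d, homogeneousComponent d f ∈ I) :
    I.IsHomogeneous (homogeneousSubmodule σ R) := fun d f hf => by
  change (decomposition.decompose' f d : MvPolynomial σ R) ∈ I
  rw [decomposition.decompose'_apply]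
  exact h f hf d

end Homogeneous

section Cone

open MvPolynomial

variable {r : ℕ} {Y Z : Set (PSpace r)} {P Q : PSpace r}

/-- The affine cone over a subset of projective space: the union of the lines that are its points.
It contains the origin, except over the empty set. -/
def affineCone (Y : Set (PSpace r)) : Set (Fin (r + 1) → ℂ) :=
  {x | ∃ Q ∈ Y, x ∈ Q.submodule}

/-- The homogeneous ideal of a subset `Y` of projective space: the ideal of all polynomials that
vanish on the affine cone over `Y`. -/
noncomputable def coneIdeal (Y : Set (PSpace r)) : Ideal (MvPolynomial (Fin (r + 1)) ℂ) :=
  vanishingIdeal ℂ (affineCone Y)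

theorem smul_rep_mem_affineCone (hQ : Q ∈ Y) (c : ℂ) : c • Q.rep ∈ affineCone Y :=
  ⟨Q, hQ, by
    rw [Projectivization.submodule_eq]
    exact Submodule.smul_mem _ c (Submodule.mem_span_singleton_self _)⟩

theorem mem_coneIdeal {f : MvPolynomial (Fin (r + 1)) ℂ} :
    f ∈ coneIdeal Y ↔ ∀ Q ∈ Y, ∀ c : ℂ, eval (c • Q.rep) f = 0 := by
  refine ⟨fun hf Q hQ c => hf _ (smul_rep_mem_affineCone hQ c), fun hf => ?_⟩
  rintro x ⟨Q, hQ, hx⟩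
  rw [Projectivization.submodule_eq, Submodule.mem_span_singleton] at hx
  obtain ⟨c, rfl⟩ := hx
  exact hf Q hQ c

theorem coneIdeal_anti (h : Y ⊆ Z) : coneIdeal Z ≤ coneIdeal Y :=
  vanishingIdeal_anti_mono fun _ ⟨Q, hQ, hx⟩ => ⟨Q, h hQ, hx⟩

theorem eval_rep_of_mem_coneIdeal {f : MvPolynomial (Fin (r + 1)) ℂ} (hf : f ∈ coneIdeal Y)
    (hQ : Q ∈ Y) : eval Q.rep f = 0 := by
  simpa using mem_coneIdeal.1 hf Q hQ 1

theorem mem_coneIdeal_of_isHomogeneous {f : MvPolynomial (Fin (r + 1)) ℂ} {d : ℕ}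
    (hf : f.IsHomogeneous d) : f ∈ coneIdeal Y ↔ ∀ Q ∈ Y, eval Q.rep f = 0 := by
  refine ⟨fun h Q hQ => eval_rep_of_mem_coneIdeal h hQ, fun h => mem_coneIdeal.2 fun Q hQ c => ?_⟩
  rw [eval_smul_of_isHomogeneous hf, h Q hQ, mul_zero]

theorem isHomogeneous_coneIdeal (Y : Set (PSpace r)) :
    (coneIdeal Y).IsHomogeneous (homogeneousSubmodule (Fin (r + 1)) ℂ) :=
  isHomogeneous_of_homogeneousComponent_mem fun _ hf d =>
    (mem_coneIdeal_of_isHomogeneous (homogeneousComponent_isHomogeneous d _)).2 fun Q hQ =>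
      eval_homogeneousComponent_eq_zero (mem_coneIdeal.1 hf Q hQ) d

theorem coneIdeal_ne_top (hY : Y.Nonempty) : coneIdeal Y ≠ ⊤ := fun h => by
  obtain ⟨Q, hQ⟩ := hY
  simpa using eval_rep_of_mem_coneIdeal ((Ideal.eq_top_iff_one _).1 h) hQ

theorem mem_zeroSet_iff_le_coneIdeal {I : Ideal (MvPolynomial (Fin (r + 1)) ℂ)}
    (hI : I.IsHomogeneous (homogeneousSubmodule (Fin (r + 1)) ℂ)) :
    Q ∈ zeroSet (I : Set (MvPolynomial (Fin (r + 1)) ℂ)) ↔ I ≤ coneIdeal {Q} := by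
  refine ⟨fun hQ f hf => ?_, fun h f hf => eval_rep_of_mem_coneIdeal (h hf) rfl⟩
  rw [← sum_homogeneousComponent f]
  refine Ideal.sum_mem _ fun d _ => ?_
  rw [mem_coneIdeal_of_isHomogeneous (homogeneousComponent_isHomogeneous d f)]
  rintro _ rfl
  exact hQ _ (homogeneousComponent_mem_of_mem hI hf d)

theorem le_coneIdeal_zeroSet {I : Ideal (MvPolynomial (Fin (r + 1)) ℂ)}
    (hI : I.IsHomogeneous (homogeneousSubmodule (Fin (r + 1)) ℂ)) :
    I ≤ coneIdeal (zeroSet (I : Set (MvPolynomial (Fin (r + 1)) ℂ))) := fun _ hf =>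
  mem_coneIdeal.2 fun _ hQ c =>
    mem_coneIdeal.1 ((mem_zeroSet_iff_le_coneIdeal hI).1 hQ hf) _ rfl c

theorem isClosed_zeroSet {S : Set (MvPolynomial (Fin (r + 1)) ℂ)}
    (hS : ∀ f ∈ S, ∃ d : ℕ, f.IsHomogeneous d) : IsClosed (zeroSet S) := by
  rw [← isOpen_compl_iff]
  change (zeroSet S)ᶜᶜ ∈ algebraicSets r
  rw [compl_compl]
  exact ⟨S, hS, rfl⟩

theorem exists_eq_zeroSet_of_isClosed (hY : IsClosed Y) :
    ∃ S : Set (MvPolynomial (Fin (r + 1)) ℂ), (∀ f ∈ S, ∃ d : ℕ, f.IsHomogeneous d) ∧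
      Y = zeroSet S := by
  have h : Yᶜᶜ ∈ algebraicSets r := hY.isOpen_compl
  rwa [compl_compl] at h

theorem isClosed_zeroSet_ideal {I : Ideal (MvPolynomial (Fin (r + 1)) ℂ)}
    (hI : I.IsHomogeneous (homogeneousSubmodule (Fin (r + 1)) ℂ)) :
    IsClosed (zeroSet (I : Set (MvPolynomial (Fin (r + 1)) ℂ))) := by
  have heq : zeroSet (I : Set (MvPolynomial (Fin (r + 1)) ℂ)) =
      zeroSet {f | f ∈ I ∧ ∃ d : ℕ, f.IsHomogeneous d} := by
    refine Set.Subset.antisymm (fun Q hQ f hf => hQ f hf.1) fun Q hQ f hf => ?_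
    rw [← sum_homogeneousComponent f, map_sum]
    exact Finset.sum_eq_zero fun d _ => hQ _ ⟨homogeneousComponent_mem_of_mem hI hf d, d,
      homogeneousComponent_isHomogeneous d f⟩
  rw [heq]
  exact isClosed_zeroSet fun f hf => hf.2

theorem zeroSet_coneIdeal (hY : IsClosed Y) :
    zeroSet (coneIdeal Y : Set (MvPolynomial (Fin (r + 1)) ℂ)) = Y := by
  refine Set.Subset.antisymm (fun Q hQ => ?_) fun Q hQ f hf => eval_rep_of_mem_coneIdeal hf hQ
  obtain ⟨S, hS, rfl⟩ := exists_eq_zeroSet_of_isClosed hY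
  intro f hf
  obtain ⟨d, hd⟩ := hS f hf
  exact hQ f ((mem_coneIdeal_of_isHomogeneous hd).2 fun Q hQ => hQ f hf)

theorem coneIdeal_le_coneIdeal_iff (hZ : IsClosed Z) : coneIdeal Z ≤ coneIdeal Y ↔ Y ⊆ Z := by
  refine ⟨fun h Q hQ => ?_, coneIdeal_anti⟩
  rw [← zeroSet_coneIdeal hZ]
  exact fun f hf => eval_rep_of_mem_coneIdeal (h hf) hQ

theorem coneIdeal_lt_coneIdeal_iff (hY : IsClosed Y) (hZ : IsClosed Z) :
    coneIdeal Z < coneIdeal Y ↔ Y ⊂ Z := by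
  rw [lt_iff_le_not_ge, coneIdeal_le_coneIdeal_iff hZ, coneIdeal_le_coneIdeal_iff hY,
    ssubset_iff_subset_not_subset]

theorem isPrime_coneIdeal_iff : (coneIdeal Y).IsPrime ↔ IsIrreducible Y := by
  refine ⟨fun hprime => ⟨?_, ?_⟩, fun hirr => ?_⟩
  · rw [Set.nonempty_iff_ne_empty]
    rintro rfl
    exact hprime.ne_top (top_unique fun f _ => mem_coneIdeal.2 fun Q hQ => hQ.elim)
  · refine isPreirreducible_iff_isClosed_union_isClosed.2 fun A B hA hB hAB => ?_
    rw [← coneIdeal_le_coneIdeal_iff hA, ← coneIdeal_le_coneIdeal_iff hB, ← hprime.mul_le,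
      Ideal.mul_le]
    refine fun f hf g hg => mem_coneIdeal.2 fun Q hQ c => ?_
    rw [map_mul, mul_eq_zero]
    exact (hAB hQ).imp (fun h => mem_coneIdeal.1 hf Q h c) fun h => mem_coneIdeal.1 hg Q h c
  · refine (isHomogeneous_coneIdeal Y).isPrime_of_homogeneous_mem_or_mem
      (coneIdeal_ne_top hirr.nonempty) ?_
    rintro f g ⟨d, hf⟩ ⟨e, hg⟩ hfg
    rw [mem_coneIdeal_of_isHomogeneous hf, mem_coneIdeal_of_isHomogeneous hg]
    refine isPreirreducible_iff_isClosed_union_isClosed.1 hirr.isPreirreducible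
      {Q | eval Q.rep f = 0} {Q | eval Q.rep g = 0} ?_ ?_ fun Q hQ => ?_
    · simpa [zeroSet] using isClosed_zeroSet (S := {f}) (by rintro _ rfl; exact ⟨d, hf⟩)
    · simpa [zeroSet] using isClosed_zeroSet (S := {g}) (by rintro _ rfl; exact ⟨e, hg⟩)
    · simpa using eval_rep_of_mem_coneIdeal hfg hQ

theorem eval_mk_rep_eq_zero_iff {f : MvPolynomial (Fin (r + 1)) ℂ} {d : ℕ} (hf : f.IsHomogeneous d)
    {x : Fin (r + 1) → ℂ} (hx : x ≠ 0) :
    eval (Projectivization.mk ℂ x hx).rep f = 0 ↔ eval x f = 0 := by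
  obtain ⟨a, ha⟩ := Projectivization.exists_smul_eq_mk_rep ℂ x hx
  rw [← ha, Units.smul_def, eval_smul_of_isHomogeneous hf,
    mul_eq_zero_iff_left (pow_ne_zero _ a.ne_zero)]

theorem mem_affineCone_zeroSet {I : Ideal (MvPolynomial (Fin (r + 1)) ℂ)}
    (hI : I.IsHomogeneous (homogeneousSubmodule (Fin (r + 1)) ℂ)) {x : Fin (r + 1) → ℂ}
    (hx : x ∈ zeroLocus ℂ I) (hx0 : x ≠ 0) :
    x ∈ affineCone (zeroSet (I : Set (MvPolynomial (Fin (r + 1)) ℂ))) := by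
  refine ⟨Projectivization.mk ℂ x hx0, fun f hf => ?_, by
    rw [Projectivization.submodule_mk]; exact Submodule.mem_span_singleton_self x⟩
  rw [← sum_homogeneousComponent f, map_sum]
  exact Finset.sum_eq_zero fun d _ =>
    (eval_mk_rep_eq_zero_iff (homogeneousComponent_isHomogeneous d f) hx0).2
      (hx _ (homogeneousComponent_mem_of_mem hI hf d))

theorem coneIdeal_zeroSet_of_isPrime {q : Ideal (MvPolynomial (Fin (r + 1)) ℂ)} [hq : q.IsPrime]
    (hhom : q.IsHomogeneous (homogeneousSubmodule (Fin (r + 1)) ℂ))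
    (hq0 : ¬ vanishingIdeal ℂ {(0 : Fin (r + 1) → ℂ)} ≤ q) :
    coneIdeal (zeroSet (q : Set (MvPolynomial (Fin (r + 1)) ℂ))) = q := by
  refine le_antisymm (fun f hf => ?_) (le_coneIdeal_zeroSet hhom)
  obtain ⟨g, hg0, hgq⟩ := SetLike.not_le_iff_exists.1 hq0
  refine (hq.mem_or_mem (?_ : f * g ∈ q)).resolve_right hgq
  rw [← IsPrime.vanishingIdeal_zeroLocus (K := ℂ) q, mem_vanishingIdeal_iff]
  intro x hx
  rw [map_mul, mul_eq_zero, or_iff_not_imp_right]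
  intro hgx
  have hx0 : x ≠ 0 := by
    rintro rfl
    exact hgx (hg0 0 rfl)
  exact hf x (mem_affineCone_zeroSet hhom hx hx0)

theorem coneIdeal_lt_vanishingIdeal_zero (hY : Y.Nonempty) :
    coneIdeal Y < vanishingIdeal ℂ {(0 : Fin (r + 1) → ℂ)} := by
  obtain ⟨Q, hQ⟩ := hY
  refine lt_of_le_not_ge (vanishingIdeal_anti_mono ?_) fun h => ?_
  · rintro _ rfl
    simpa using smul_rep_mem_affineCone hQ 0
  · refine Q.rep_nonzero (funext fun j => ?_)
    have hX : X j ∈ vanishingIdeal ℂ {(0 : Fin (r + 1) → ℂ)} := by simp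
    simpa using eval_rep_of_mem_coneIdeal (h hX) hQ

instance : T1Space (PSpace r) := by
  refine ⟨fun P => ?_⟩
  obtain ⟨j, hj⟩ := Function.ne_iff.1 P.rep_nonzero
  have heq : {P} = zeroSet (Set.range fun i => C (P.rep j) * X i - C (P.rep i) * X j) := by
    refine Set.Subset.antisymm ?_ fun Q hQ => ?_
    · rintro _ rfl _ ⟨i, rfl⟩
      simp [mul_comm]
    · rw [Set.mem_singleton_iff, ← Q.mk_rep, ← P.mk_rep, Projectivization.mk_eq_mk_iff']
      refine ⟨Q.rep j / P.rep j, funext fun i => ?_⟩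
      have hi := hQ _ ⟨i, rfl⟩
      simp only [map_sub, map_mul, eval_C, eval_X, sub_eq_zero] at hi
      rw [Pi.smul_apply, smul_eq_mul, div_mul_eq_mul_div, div_eq_iff hj]
      linear_combination -hi
  rw [heq]
  refine isClosed_zeroSet ?_
  rintro _ ⟨i, rfl⟩
  exact ⟨1, (isHomogeneous_C_mul_X _ _).sub (isHomogeneous_C_mul_X _ _)⟩

end Cone

section KrullDimension

open MvPolynomial

variable {r : ℕ}

theorem topologicalKrullDim_pos_iff_nontrivial {T : Type*} [TopologicalSpace T] [T1Space T]
    [IrreducibleSpace T] : 0 < topologicalKrullDim T ↔ Nontrivial T := by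
  rw [topologicalKrullDim, Order.krullDim_pos_iff]
  refine ⟨fun ⟨A, B, hAB⟩ => ?_, fun h => ?_⟩
  · rw [← not_subsingleton_iff_nontrivial]
    intro h
    refine hAB.ne (TopologicalSpace.IrreducibleCloseds.ext ?_)
    rw [A.isIrreducible.nonempty.eq_univ, B.isIrreducible.nonempty.eq_univ]
  · obtain ⟨x, y, hxy⟩ := h
    refine ⟨⟨{x}, isIrreducible_singleton, isClosed_singleton⟩,
      ⟨Set.univ, IrreducibleSpace.isIrreducible_univ T, isClosed_univ⟩,
      SetLike.coe_ssubset_coe.1 ⟨Set.subset_univ _, fun hsub => ?_⟩⟩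
    exact hxy (Set.mem_singleton_iff.1 (hsub (Set.mem_univ y))).symm

theorem topologicalKrullDim_pos_iff_coneIdeal_lt {Z : Set (PSpace r)} {P : PSpace r}
    (hZ : IsClosed Z) (hirr : IsIrreducible Z) (hP : P ∈ Z) :
    0 < topologicalKrullDim Z ↔ coneIdeal Z < coneIdeal {P} := by
  have := Subtype.irreducibleSpace hirr
  rw [topologicalKrullDim_pos_iff_nontrivial, coneIdeal_lt_coneIdeal_iff isClosed_singleton hZ,
    Set.nontrivial_coe_sort, Set.nontrivial_iff_ne_singleton hP, Set.ssubset_iff_subset_ne,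
    Set.singleton_subset_iff, and_iff_right hP, ne_comm]

/-- The vertex of the cone, which is not a point of projective space, accounts for the `+ 1`. -/
theorem topologicalKrullDim_add_one_le_ringKrullDim {X : Set (PSpace r)} (hX : IsClosed X)
    (hirr : IsIrreducible X) :
    topologicalKrullDim X + 1 ≤
      ringKrullDim (MvPolynomial (Fin (r + 1)) ℂ ⧸ coneIdeal X) := by
  have := Subtype.irreducibleSpace hirr
  have : Nonempty (TopologicalSpace.IrreducibleCloseds X) :=
    ⟨⟨Set.univ, IrreducibleSpace.isIrreducible_univ _, isClosed_univ⟩⟩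
  have hZirr (Z : TopologicalSpace.IrreducibleCloseds X) :
      IsIrreducible (Subtype.val '' (Z : Set X)) :=
    Z.isIrreducible.image _ continuous_subtype_val.continuousOn
  have hZcl (Z : TopologicalSpace.IrreducibleCloseds X) : IsClosed (Subtype.val '' (Z : Set X)) :=
    hX.isClosedEmbedding_subtypeVal.isClosedMap _ Z.isClosed
  rw [ringKrullDim_quotient, topologicalKrullDim, ← Order.krullDim_withBot,
    ← Order.krullDim_orderDual (α := PrimeSpectrum.zeroLocus _)]
  let φ : WithBot (TopologicalSpace.IrreducibleCloseds X) →
      (PrimeSpectrum.zeroLocus (coneIdeal X : Set (MvPolynomial (Fin (r + 1)) ℂ)))ᵒᵈ :=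
    fun Z => OrderDual.toDual <| WithBot.recBotCoe
      ⟨⟨vanishingIdeal ℂ {0}, inferInstance⟩,
        (coneIdeal_lt_vanishingIdeal_zero hirr.nonempty).le⟩
      (fun Z => ⟨⟨coneIdeal (Subtype.val '' (Z : Set X)), isPrime_coneIdeal_iff.2 (hZirr Z)⟩,
        coneIdeal_anti (Subtype.coe_image_subset X Z)⟩) Z
  refine Order.krullDim_le_of_strictMono φ fun Z W hZW => ?_
  induction W using WithBot.recBotCoe with
  | bot => exact absurd hZW not_lt_bot
  | coe W =>
    induction Z using WithBot.recBotCoe with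
    | bot => exact coneIdeal_lt_vanishingIdeal_zero (hZirr W).nonempty
    | coe Z =>
      exact (coneIdeal_lt_coneIdeal_iff (hZcl Z) (hZcl W)).2
        (Subtype.val_injective.image_strictMono
          (SetLike.coe_ssubset_coe.2 (WithBot.coe_lt_coe.1 hZW)))

end KrullDimension

section TangentSpace

open MvPolynomial

section Gradient

variable {σ R : Type*} [CommRing R]

/-- The gradient at the point `p`, as a linear map on polynomials. -/
noncomputable def gradient (p : σ → R) : MvPolynomial σ R →ₗ[R] (σ → R) :=
  LinearMap.pi fun j => (aeval p).toLinearMap ∘ₗ (pderiv j).toLinearMap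

theorem gradient_apply (p : σ → R) (f : MvPolynomial σ R) (j : σ) :
    gradient p f j = eval p (pderiv j f) := rfl

theorem gradient_C (p : σ → R) (a : R) : gradient p (C a) = 0 :=
  funext fun j => by rw [gradient_apply, pderiv_C, map_zero, Pi.zero_apply]

theorem gradient_X [DecidableEq σ] (p : σ → R) (i : σ) : gradient p (X i) = Pi.single i 1 :=
  funext fun j => by
    rw [gradient_apply, pderiv_X, Pi.single_comm, Pi.single_apply, Pi.single_apply]
    split_ifs <;> simp

theorem gradient_mul (p : σ → R) (f g : MvPolynomial σ R) :
    gradient p (f * g) = eval p f • gradient p g + eval p g • gradient p f :=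
  funext fun j => by
    simp only [gradient_apply, pderiv_mul, map_add, map_mul, Pi.add_apply, Pi.smul_apply,
      smul_eq_mul]
    ring

section LinearForm

variable [Fintype σ]

/-- The linear form with the given vector of coefficients. -/
noncomputable def linearForm : (σ → R) →ₗ[R] MvPolynomial σ R :=
  Fintype.linearCombination R X

theorem linearForm_apply (w : σ → R) : linearForm w = ∑ j, C (w j) * X j := by
  simp only [linearForm, Fintype.linearCombination_apply, smul_eq_C_mul]

theorem isHomogeneous_linearForm (w : σ → R) : (linearForm w).IsHomogeneous 1 := by
  rw [linearForm_apply]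
  exact IsHomogeneous.sum _ _ _ fun j _ => isHomogeneous_C_mul_X _ _

theorem gradient_linearForm (p w : σ → R) : gradient p (linearForm w) = w := by
  classical
  simp only [linearForm, Fintype.linearCombination_apply, map_sum, map_smul, gradient_X]
  exact (pi_eq_sum_univ' w).symm

theorem sub_taylor_mem_ker_eval_sq (p : σ → R) (f : MvPolynomial σ R) :
    f - C (eval p f) - ∑ j, C (gradient p f j) * (X j - C (p j)) ∈ RingHom.ker (eval p) ^ 2 := by
  classical
  induction f using MvPolynomial.induction_on with
  | C a => simp [gradient_C]
  | add f g hf hg =>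
    convert Ideal.add_mem _ hf hg using 1
    simp only [map_add, Pi.add_apply, add_mul, Finset.sum_add_distrib]
    ring
  | mul_X f i hf =>
    have hmul : (f - C (eval p f)) * (X i - C (p i)) ∈ RingHom.ker (eval p) ^ 2 := by
      rw [pow_two]
      exact Ideal.mul_mem_mul (by simp [RingHom.mem_ker]) (by simp [RingHom.mem_ker])
    convert Ideal.add_mem _ hmul (Ideal.mul_mem_left _ (C (p i)) hf) using 1
    have hsum : ∑ j, C (gradient p (f * X i) j) * (X j - C (p j)) =
        C (eval p f) * (X i - C (p i)) + C (p i) * ∑ j, C (gradient p f j) * (X j - C (p j)) := by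
      simp [gradient_mul, gradient_X, Pi.single_apply, add_mul, Finset.sum_add_distrib,
        Finset.mul_sum, mul_assoc, apply_ite C]
    rw [hsum, map_mul, map_mul, eval_X]
    ring

end LinearForm

variable [Finite σ]

theorem mem_ker_eval_sq_of_gradient_eq_zero {p : σ → R} {f : MvPolynomial σ R}
    (hf : f ∈ RingHom.ker (eval p)) (hgrad : gradient p f = 0) : f ∈ RingHom.ker (eval p) ^ 2 := by
  cases nonempty_fintype σ
  simpa [RingHom.mem_ker.1 hf, hgrad] using sub_taylor_mem_ker_eval_sq p f

theorem exists_mem_ker_eval_gradient_eq (p w : σ → R) :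
    ∃ f ∈ RingHom.ker (eval p), gradient p f = w := by
  cases nonempty_fintype σ
  refine ⟨linearForm w - C (eval p (linearForm w)), by simp [RingHom.mem_ker], ?_⟩
  rw [map_sub, gradient_linearForm, gradient_C, sub_zero]

end Gradient

section ConormalSpace

variable {σ K : Type*} [Field K]

/-- The space of gradients at `p` of the elements of `I`: for `p` a zero of `I`, the conormal space
at `p` of the affine scheme defined by `I`. -/
noncomputable def conormalSpace (I : Ideal (MvPolynomial σ K)) (p : σ → K) : Submodule K (σ → K) :=
  (I.restrictScalars K).map (gradient p)

theorem gradient_mem_conormalSpace {I : Ideal (MvPolynomial σ K)} {f : MvPolynomial σ K}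
    (hf : f ∈ I) (p : σ → K) : gradient p f ∈ conormalSpace I p :=
  Submodule.mem_map_of_mem hf

/-- The homogeneous polynomials that belong to the ideal `I`. -/
def homogeneousElements (I : Ideal (MvPolynomial σ K)) : Set (MvPolynomial σ K) :=
  {f | f ∈ I ∧ ∃ d : ℕ, f.IsHomogeneous d}

theorem conormalSpace_eq_span {I : Ideal (MvPolynomial σ K)}
    (hI : I.IsHomogeneous (homogeneousSubmodule σ K)) (p : σ → K) :
    conormalSpace I p = Submodule.span K (gradient p '' homogeneousElements I) := by
  refine le_antisymm ?_ (Submodule.span_le.2 ?_)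
  · rintro _ ⟨f, hf, rfl⟩
    rw [← sum_homogeneousComponent f, map_sum]
    exact Submodule.sum_mem _ fun d _ => Submodule.subset_span ⟨_,
      ⟨homogeneousComponent_mem_of_mem hI hf d, d, homogeneousComponent_isHomogeneous d f⟩, rfl⟩
  · rintro _ ⟨f, hf, rfl⟩
    exact gradient_mem_conormalSpace hf.1 p

variable [Finite σ]

theorem ker_eval_le_sup_span_sup_sq {I : Ideal (MvPolynomial σ K)} {p : σ → K}
    {s : Set (MvPolynomial σ K)} (hI : I ≤ RingHom.ker (eval p))
    (hs : s ⊆ RingHom.ker (eval p))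
    (h : conormalSpace I p ⊔ Submodule.span K (gradient p '' s) = ⊤) :
    RingHom.ker (eval p) ≤ I ⊔ Ideal.span s ⊔ RingHom.ker (eval p) ^ 2 := by
  intro g hg
  obtain ⟨_, ⟨f, hf, rfl⟩, u, hu, hfu⟩ :=
    Submodule.mem_sup.1 (h ▸ Submodule.mem_top (x := gradient p g))
  rw [← Submodule.map_span] at hu
  obtain ⟨l, hl, rfl⟩ := hu
  replace hl : l ∈ Ideal.span s := Submodule.span_le_restrictScalars K _ s hl
  have hrest : g - (f + l) ∈ RingHom.ker (eval p) ^ 2 := by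
    refine mem_ker_eval_sq_of_gradient_eq_zero
      (sub_mem hg (add_mem (hI hf) (Ideal.span_le.2 hs hl))) ?_
    rw [map_sub, map_add, hfu, sub_self]
  rw [← add_sub_cancel (f + l) g]
  exact add_mem (Ideal.mem_sup_left (add_mem (Ideal.mem_sup_left hf) (Ideal.mem_sup_right hl)))
    (Ideal.mem_sup_right hrest)

theorem exists_finset_conormalSpace_sup_span_eq_top (I : Ideal (MvPolynomial σ K)) (p : σ → K) :
    ∃ s : Finset (MvPolynomial σ K), (s : Set (MvPolynomial σ K)) ⊆ RingHom.ker (eval p) ∧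
      conormalSpace I p ⊔ Submodule.span K (gradient p '' s) = ⊤ ∧
      s.card ≤ Module.finrank K ((σ → K) ⧸ conormalSpace I p) := by
  classical
  let b := Module.finBasis K ((σ → K) ⧸ conormalSpace I p)
  have hlift : ∀ i, ∃ f ∈ RingHom.ker (eval p), (conormalSpace I p).mkQ (gradient p f) = b i := by
    intro i
    obtain ⟨w, hw⟩ := Submodule.mkQ_surjective _ (b i)
    obtain ⟨f, hf, rfl⟩ := exists_mem_ker_eval_gradient_eq p w
    exact ⟨f, hf, hw⟩
  choose f hf hfb using hlift
  refine ⟨Finset.univ.image f, ?_, ?_, Finset.card_image_le.trans (by simp)⟩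
  · simpa [Set.range_subset_iff] using hf
  · rw [← Submodule.map_mkQ_eq_top, Submodule.map_span, Finset.coe_image, Finset.coe_univ,
      Set.image_univ, ← Set.range_comp, ← Set.range_comp, ← b.span_eq]
    exact congrArg _ (congrArg _ (funext hfb))

theorem ringKrullDim_quotient_le_finrank_quotient_conormalSpace {I : Ideal (MvPolynomial σ K)}
    [I.IsPrime] {p : σ → K} (hI : I ≤ RingHom.ker (eval p)) :
    ringKrullDim (MvPolynomial σ K ⧸ I) ≤ Module.finrank K ((σ → K) ⧸ conormalSpace I p) := by
  classical
  obtain ⟨s, hs, hsup, hcard⟩ := exists_finset_conormalSpace_sup_span_eq_top I p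
  let π := Ideal.Quotient.mk I
  have hmax : (RingHom.ker (eval p)).IsMaximal :=
    RingHom.ker_isMaximal_of_surjective _ fun c => ⟨C c, by simp⟩
  have hM : ((RingHom.ker (eval p)).map π).IsMaximal :=
    Ideal.IsMaximal.map_of_surjective_of_ker_le Ideal.Quotient.mk_surjective (by simpa [π] using hI)
  have hle : (RingHom.ker (eval p)).map π ≤
      Ideal.span (s.image π : Finset _) ⊔ (RingHom.ker (eval p)).map π ^ 2 := by
    refine (Ideal.map_mono (ker_eval_le_sup_span_sup_sq hI hs hsup)).trans ?_
    rw [Ideal.map_sup, Ideal.map_sup, Ideal.map_quotient_self, bot_sup_eq, Ideal.map_span,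
      Ideal.map_pow, Finset.coe_image]
  have hheight : ((RingHom.ker (eval p)).map π).height ≤ (s.image π).card := by
    refine height_le_card_of_le_span_sup_sq ?_ hle
    rw [Finset.coe_image]
    exact Set.image_subset_iff.2 fun f hf => Ideal.mem_map_of_mem π (hs hf)
  refine (ringKrullDim_le_height_of_isMaximal K ((RingHom.ker (eval p)).map π)).trans ?_
  exact_mod_cast hheight.trans (Nat.cast_le.2 (Finset.card_image_le.trans hcard))

end ConormalSpace

section EmbeddedTangentSpace

variable {r : ℕ} {X : Set (PSpace r)}

theorem tangentSpace_eq_dualCoannihilator (X : Set (PSpace r)) (P : PSpace r) :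
    tangentSpace X P = ((conormalSpace (coneIdeal X) P.rep).map
      (dotProductEquiv ℂ (Fin (r + 1))).toLinearMap).dualCoannihilator := by
  rw [conormalSpace_eq_span (isHomogeneous_coneIdeal X), Submodule.map_span]
  ext v
  rw [Submodule.mem_dualCoannihilator]
  constructor
  · intro hv φ hφ
    have hle : Submodule.span ℂ (dotProductEquiv ℂ (Fin (r + 1)) ''
        (gradient P.rep '' homogeneousElements (coneIdeal X))) ≤
        LinearMap.ker (Module.Dual.eval ℂ _ v) := by
      rw [Submodule.span_le]
      rintro _ ⟨_, ⟨f, ⟨hf, hd⟩, rfl⟩, rfl⟩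
      exact hv f hd fun Q hQ => eval_rep_of_mem_coneIdeal hf hQ
    exact hle hφ
  · rintro h f ⟨d, hd⟩ hf
    exact h _ (Submodule.subset_span
      ⟨_, ⟨f, ⟨(mem_coneIdeal_of_isHomogeneous hd).2 hf, d, hd⟩, rfl⟩, rfl⟩)

theorem finrank_conormalSpace_add_finrank_tangentSpace (X : Set (PSpace r)) (P : PSpace r) :
    Module.finrank ℂ (conormalSpace (coneIdeal X) P.rep) +
      Module.finrank ℂ (tangentSpace X P) = r + 1 := by
  have := Subspace.finrank_add_finrank_dualCoannihilator_eq
    ((conormalSpace (coneIdeal X) P.rep).map (dotProductEquiv ℂ (Fin (r + 1))).toLinearMap)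
  rwa [← tangentSpace_eq_dualCoannihilator, LinearEquiv.finrank_map_eq,
    Module.finrank_fin_fun] at this

theorem mem_conormalSpace_coneIdeal_iff {P : PSpace r} {h : Fin (r + 1) → ℂ} :
    h ∈ conormalSpace (coneIdeal X) P.rep ↔ ∀ v ∈ tangentSpace X P, h ⬝ᵥ v = 0 := by
  have hann := Subspace.dualCoannihilator_dualAnnihilator_eq
    (W := (conormalSpace (coneIdeal X) P.rep).map (dotProductEquiv ℂ (Fin (r + 1))).toLinearMap)
  rw [← tangentSpace_eq_dualCoannihilator] at hann
  have hmap : h ∈ conormalSpace (coneIdeal X) P.rep ↔ dotProductEquiv ℂ (Fin (r + 1)) h ∈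
      (conormalSpace (coneIdeal X) P.rep).map (dotProductEquiv ℂ (Fin (r + 1))).toLinearMap := by
    rw [Submodule.mem_map_equiv, LinearEquiv.symm_apply_apply]
  rw [hmap, ← hann, Submodule.mem_dualAnnihilator]
  rfl

theorem topologicalKrullDim_add_one_le_finrank_tangentSpace (hX : IsClosed X)
    (hirr : IsIrreducible X) {P : PSpace r} (hP : P ∈ X) :
    topologicalKrullDim X + 1 ≤ (Module.finrank ℂ (tangentSpace X P) : WithBot ℕ∞) := by
  have := isPrime_coneIdeal_iff.2 hirr
  have hfinrank : Module.finrank ℂ ((Fin (r + 1) → ℂ) ⧸ conormalSpace (coneIdeal X) P.rep) =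
      Module.finrank ℂ (tangentSpace X P) := by
    have hquot := (conormalSpace (coneIdeal X) P.rep).finrank_quotient_add_finrank
    have hsum := finrank_conormalSpace_add_finrank_tangentSpace X P
    rw [Module.finrank_fin_fun] at hquot
    omega
  rw [← hfinrank]
  exact (topologicalKrullDim_add_one_le_ringKrullDim hX hirr).trans
    (ringKrullDim_quotient_le_finrank_quotient_conormalSpace fun f hf =>
      eval_rep_of_mem_coneIdeal hf hP)

end EmbeddedTangentSpace

end TangentSpace

section JacobianMinor

open MvPolynomial

theorem isHomogeneous_det {σ ι R : Type*} [CommRing R] [Fintype ι] [DecidableEq ι]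
    {M : Matrix ι ι (MvPolynomial σ R)} {d : ι → ℕ} (hM : ∀ i j, (M i j).IsHomogeneous (d i)) :
    M.det.IsHomogeneous (∑ i, d i) := by
  rw [Matrix.det_apply]
  refine IsHomogeneous.sum _ _ _ fun τ _ => ?_
  rw [Units.smul_def, ← Equiv.sum_comp τ d]
  exact Submodule.smul_of_tower_mem (homogeneousSubmodule σ R _) _
    (IsHomogeneous.prod _ _ _ fun i _ => hM (τ i) i)

theorem exists_det_submatrix_ne_zero_iff {σ K : Type*} [Field K] [Finite σ] {n : ℕ}
    {w : Fin n → σ → K} :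
    (∃ e : Fin n → σ, ((Matrix.of w).submatrix id e).det ≠ 0) ↔ LinearIndependent K w := by
  constructor
  · rintro ⟨e, he⟩
    exact LinearIndependent.of_comp (LinearMap.funLeft K K e)
      (Matrix.linearIndependent_rows_of_det_ne_zero he)
  · intro hw
    cases nonempty_fintype σ
    have hcols := Submodule.exists_fun_fin_finrank_span_eq K (Set.range (Matrix.of w).col)
    rw [← Matrix.rank_eq_finrank_span_cols, LinearIndependent.rank_matrix (M := Matrix.of w) hw,
      Fintype.card_fin] at hcols
    obtain ⟨v, hv, -, hli⟩ := hcols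
    choose e he using hv
    rw [← funext he] at hli
    have hunit : IsUnit ((Matrix.of w).submatrix id e) :=
      Matrix.linearIndependent_cols_iff_isUnit.1 hli
    exact ⟨e, ((Matrix.isUnit_iff_isUnit_det _).1 hunit).ne_zero⟩

section Minor

variable {σ R : Type*} [CommRing R] {n : ℕ}

/-- The minor of the Jacobian matrix of `F` that is formed by the columns `e`. -/
noncomputable def jacobianMinor (F : Fin n → MvPolynomial σ R) (e : Fin n → σ) :
    MvPolynomial σ R :=
  (Matrix.of fun i j => pderiv (e j) (F i)).det

theorem isHomogeneous_jacobianMinor {F : Fin n → MvPolynomial σ R} {d : Fin n → ℕ}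
    (hF : ∀ i, (F i).IsHomogeneous (d i)) (e : Fin n → σ) :
    (jacobianMinor F e).IsHomogeneous (∑ i, (d i - 1)) :=
  isHomogeneous_det fun i _ => (hF i).pderiv

theorem jacobianMinor_cons_add_smul (f g : MvPolynomial σ R) (a : R)
    (F : Fin n → MvPolynomial σ R) (e : Fin (n + 1) → σ) :
    jacobianMinor (Fin.cons (f + a • g) F) e =
      jacobianMinor (Fin.cons f F) e + a • jacobianMinor (Fin.cons g F) e := by
  simp only [jacobianMinor, Matrix.det_succ_row_zero, Matrix.of_apply, Fin.cons_zero, map_add,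
    Derivation.map_smul, Finset.smul_sum, ← Finset.sum_add_distrib]
  refine Finset.sum_congr rfl fun j _ => ?_
  have hsub (u : MvPolynomial σ R) : (Matrix.of fun (i : Fin (n + 1)) j =>
        pderiv (e j) ((Fin.cons u F : Fin (n + 1) → MvPolynomial σ R) i)).submatrix Fin.succ
          j.succAbove =
      Matrix.of fun i k => pderiv (e (j.succAbove k)) (F i) := rfl
  simp only [hsub, smul_eq_C_mul]
  ring

end Minor

variable {σ K : Type*} [Field K] {n : ℕ} {I : Ideal (MvPolynomial σ K)} {p : σ → K}

section Finite

variable [Finite σ]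

theorem exists_eval_jacobianMinor_ne_zero_iff {F : Fin n → MvPolynomial σ K} :
    (∃ e, eval p (jacobianMinor F e) ≠ 0) ↔ LinearIndependent K fun i => gradient p (F i) := by
  rw [← exists_det_submatrix_ne_zero_iff]
  refine exists_congr fun e => ?_
  rw [jacobianMinor, RingHom.map_det]
  rfl

theorem le_finrank_conormalSpace_of_linearIndependent {F : Fin n → MvPolynomial σ K}
    (hli : LinearIndependent K fun i => gradient p (F i))
    (hF : ∀ i, gradient p (F i) ∈ conormalSpace I p) :
    n ≤ Module.finrank K (conormalSpace I p) := by
  have hli' : LinearIndependent K fun i => (⟨_, hF i⟩ : conormalSpace I p) :=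
    LinearIndependent.of_comp (conormalSpace I p).subtype hli
  simpa using hli'.fintype_card_le_finrank

theorem exists_homogeneousElements_linearIndependent_gradient
    (hI : I.IsHomogeneous (homogeneousSubmodule σ K))
    (hn : Module.finrank K (conormalSpace I p) = n) :
    ∃ F : Fin n → MvPolynomial σ K, (∀ i, F i ∈ homogeneousElements I) ∧
      LinearIndependent K (fun i => gradient p (F i)) := by
  subst hn
  rw [conormalSpace_eq_span hI]
  obtain ⟨w, hw, -, hli⟩ :=
    Submodule.exists_fun_fin_finrank_span_eq K (gradient p '' homogeneousElements I)
  choose F hF hFw using hw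
  exact ⟨F, hF, by rwa [funext hFw]⟩

end Finite

theorem mem_conormalSpace_iff_jacobianMinor [Fintype σ]
    (hI : I.IsHomogeneous (homogeneousSubmodule σ K))
    (hn : Module.finrank K (conormalSpace I p) = n) {h : σ → K} :
    h ∈ conormalSpace I p ↔ ∀ F : Fin n → MvPolynomial σ K, (∀ i, F i ∈ homogeneousElements I) →
      ∀ e, eval p (jacobianMinor (Fin.cons (linearForm h) F) e) = 0 := by
  have hcons (F : Fin n → MvPolynomial σ K) :
      (fun i => gradient p ((Fin.cons (linearForm h) F : Fin (n + 1) → MvPolynomial σ K) i)) =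
        Fin.cons h fun i => gradient p (F i) := by
    funext i
    refine Fin.cases ?_ (fun i => ?_) i
    · exact gradient_linearForm p h
    · rfl
  constructor
  · intro hh F hF e
    by_contra hne
    have hli := exists_eval_jacobianMinor_ne_zero_iff.1 ⟨e, hne⟩
    refine (Nat.lt_succ_self n).not_ge
      ((le_finrank_conormalSpace_of_linearIndependent (I := I) hli fun i => ?_).trans_eq hn)
    refine Fin.cases ?_ (fun i => ?_) i
    · exact (gradient_linearForm p h).symm ▸ hh
    · exact gradient_mem_conormalSpace (hF i).1 p
  · intro hzero
    obtain ⟨F, hF, hli⟩ := exists_homogeneousElements_linearIndependent_gradient hI hn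
    by_contra hh
    have hspan : h ∉ Submodule.span K (Set.range fun i => gradient p (F i)) := fun hmem =>
      hh (Submodule.span_le.2 (Set.range_subset_iff.2 fun i =>
        gradient_mem_conormalSpace (hF i).1 p) hmem)
    obtain ⟨e, he⟩ := exists_eval_jacobianMinor_ne_zero_iff.2
      ((hcons F).symm ▸ linearIndependent_finCons.2 ⟨hli, hspan⟩)
    exact he (hzero F hF e)

end JacobianMinor

section SmoothLocus

open MvPolynomial

variable {r : ℕ} {X Z : Set (PSpace r)} {P Q : PSpace r}

theorem finrank_conormalSpace_le_of_mem_smoothLocus (hX : IsClosed X) (hirr : IsIrreducible X)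
    (hP : P ∈ smoothLocus X) (hQ : Q ∈ X) :
    Module.finrank ℂ (conormalSpace (coneIdeal X) Q.rep) ≤
      Module.finrank ℂ (conormalSpace (coneIdeal X) P.rep) := by
  have hle := topologicalKrullDim_add_one_le_finrank_tangentSpace hX hirr hQ
  rw [← hP.2, Nat.cast_le] at hle
  have hsumP := finrank_conormalSpace_add_finrank_tangentSpace X P
  have hsumQ := finrank_conormalSpace_add_finrank_tangentSpace X Q
  omega

theorem mem_smoothLocus_iff_finrank_conormalSpace_eq (hP : P ∈ smoothLocus X) :
    Q ∈ smoothLocus X ↔ Q ∈ X ∧ Module.finrank ℂ (conormalSpace (coneIdeal X) Q.rep) =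
      Module.finrank ℂ (conormalSpace (coneIdeal X) P.rep) := by
  refine and_congr_right fun _ => ?_
  rw [← hP.2, Nat.cast_inj]
  have hsumP := finrank_conormalSpace_add_finrank_tangentSpace X P
  have hsumQ := finrank_conormalSpace_add_finrank_tangentSpace X Q
  omega

theorem exists_isHomogeneous_eval_ne_zero_subset_smoothLocus (hX : IsClosed X)
    (hirr : IsIrreducible X) (hP : P ∈ smoothLocus X) :
    ∃ (g : MvPolynomial (Fin (r + 1)) ℂ) (d : ℕ), g.IsHomogeneous d ∧ eval P.rep g ≠ 0 ∧
      ∀ Q ∈ X, eval Q.rep g ≠ 0 → Q ∈ smoothLocus X := by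
  obtain ⟨F, hF, hli⟩ :=
    exists_homogeneousElements_linearIndependent_gradient (isHomogeneous_coneIdeal X) rfl
  obtain ⟨e, he⟩ := exists_eval_jacobianMinor_ne_zero_iff.2 hli
  choose hFX d hd using hF
  refine ⟨_, _, isHomogeneous_jacobianMinor hd e, he, fun Q hQ hne => ?_⟩
  rw [mem_smoothLocus_iff_finrank_conormalSpace_eq hP]
  exact ⟨hQ, (finrank_conormalSpace_le_of_mem_smoothLocus hX hirr hP hQ).antisymm
    (le_finrank_conormalSpace_of_linearIndependent
      (exists_eval_jacobianMinor_ne_zero_iff.1 ⟨e, hne⟩)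
      fun i => gradient_mem_conormalSpace (hFX i) _)⟩

theorem mem_coneIdeal_iff_forall_mem_smoothLocus (hX : IsClosed X) (hirr : IsIrreducible X)
    (hP : P ∈ smoothLocus X) (hZ : IsIrreducible Z) (hZX : Z ⊆ X) (hPZ : P ∈ Z)
    {f : MvPolynomial (Fin (r + 1)) ℂ} {d : ℕ} (hf : f.IsHomogeneous d) :
    f ∈ coneIdeal Z ↔ ∀ Q ∈ Z, Q ∈ smoothLocus X → eval Q.rep f = 0 := by
  refine ⟨fun h Q hQ _ => eval_rep_of_mem_coneIdeal h hQ, fun h => ?_⟩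
  obtain ⟨g, e, hg, hgP, hgX⟩ := exists_isHomogeneous_eval_ne_zero_subset_smoothLocus hX hirr hP
  have hgf : g * f ∈ coneIdeal Z := by
    rw [mem_coneIdeal_of_isHomogeneous (hg.mul hf)]
    intro Q hQ
    rw [map_mul, mul_eq_zero, or_iff_not_imp_left]
    exact fun hgQ => h Q hQ (hgX Q (hZX hQ) hgQ)
  exact ((isPrime_coneIdeal_iff.2 hZ).mem_or_mem hgf).resolve_left fun hgZ =>
    hgP (eval_rep_of_mem_coneIdeal hgZ hPZ)

end SmoothLocus

section TangencyIdeal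

open MvPolynomial

variable {σ K : Type*} [Field K] [Fintype σ] {I : Ideal (MvPolynomial σ K)} {c : ℕ} {h h' : σ → K}

/-- The ideal whose zeros, where the conormal space of `I` has dimension `c`, are the points at
which `h` belongs to that conormal space. It is generated by `I` and by the minors that express the
linear dependence of `h` and the gradients of `c` elements of `I`. -/
noncomputable def tangencyIdeal (I : Ideal (MvPolynomial σ K)) (c : ℕ) (h : σ → K) :
    Ideal (MvPolynomial σ K) :=
  I ⊔ Ideal.span {g | ∃ F : Fin c → MvPolynomial σ K, (∀ i, F i ∈ homogeneousElements I) ∧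
    ∃ e, jacobianMinor (Fin.cons (linearForm h) F) e = g}

/-- The ideal of the family of tangency ideals along the pencil `h + t • h'`, the parameter `t`
being the polynomial variable. -/
noncomputable def tangencyPencilIdeal (I : Ideal (MvPolynomial σ K)) (c : ℕ) (h h' : σ → K) :
    Ideal (Polynomial (MvPolynomial σ K)) :=
  I.map Polynomial.C ⊔
    Ideal.span {g | ∃ F : Fin c → MvPolynomial σ K, (∀ i, F i ∈ homogeneousElements I) ∧
      ∃ e, Polynomial.C (jacobianMinor (Fin.cons (linearForm h) F) e) +
        Polynomial.X * Polynomial.C (jacobianMinor (Fin.cons (linearForm h') F) e) = g}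

theorem tangencyIdeal_le_iff {p : Ideal (MvPolynomial σ K)} : tangencyIdeal I c h ≤ p ↔
    I ≤ p ∧ ∀ F : Fin c → MvPolynomial σ K, (∀ i, F i ∈ homogeneousElements I) →
      ∀ e, jacobianMinor (Fin.cons (linearForm h) F) e ∈ p := by
  rw [tangencyIdeal, sup_le_iff, Ideal.span_le]
  refine and_congr_right fun _ => ⟨fun hp F hF e => hp ⟨F, hF, e, rfl⟩, ?_⟩
  rintro hp _ ⟨F, hF, e, rfl⟩
  exact hp F hF e

theorem exists_isHomogeneous_jacobianMinor_cons_linearForm {F : Fin c → MvPolynomial σ K}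
    (hF : ∀ i, F i ∈ homogeneousElements I) (e : Fin (c + 1) → σ) :
    ∃ d : ℕ, (jacobianMinor (Fin.cons (linearForm h) F) e).IsHomogeneous d := by
  choose _ d hd using hF
  refine ⟨_, isHomogeneous_jacobianMinor (d := Fin.cons 1 d) (fun i => ?_) e⟩
  exact Fin.cases (isHomogeneous_linearForm h) hd i

theorem isHomogeneous_tangencyIdeal (hI : I.IsHomogeneous (homogeneousSubmodule σ K)) :
    (tangencyIdeal I c h).IsHomogeneous (homogeneousSubmodule σ K) := by
  refine hI.sup (Ideal.homogeneous_span _ _ ?_)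
  rintro _ ⟨F, hF, e, rfl⟩
  exact exists_isHomogeneous_jacobianMinor_cons_linearForm hF e

theorem map_evalRingHom_tangencyPencilIdeal (t : K) :
    (tangencyPencilIdeal I c h h').map
      (Polynomial.evalRingHom (algebraMap K (MvPolynomial σ K) t)) =
      tangencyIdeal I c (h + t • h') := by
  have hC : (Polynomial.evalRingHom (algebraMap K (MvPolynomial σ K) t)).comp Polynomial.C =
      RingHom.id _ := RingHom.ext fun _ => Polynomial.eval_C
  rw [tangencyPencilIdeal, Ideal.map_sup, Ideal.map_map, hC, Ideal.map_id, Ideal.map_span,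
    tangencyIdeal]
  congr 2
  ext g
  have heval : ∀ (F : Fin c → MvPolynomial σ K) e,
      (Polynomial.C (jacobianMinor (Fin.cons (linearForm h) F) e) +
        Polynomial.X * Polynomial.C (jacobianMinor (Fin.cons (linearForm h') F) e)).eval
          (algebraMap K (MvPolynomial σ K) t) =
      jacobianMinor (Fin.cons (linearForm (h + t • h')) F) e := fun F e => by
    rw [map_add, map_smul, jacobianMinor_cons_add_smul, Polynomial.eval_add, Polynomial.eval_C,
      Polynomial.eval_mul, Polynomial.eval_X, Polynomial.eval_C, ← Algebra.smul_def]
  constructor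
  · rintro ⟨_, ⟨F, hF, e, rfl⟩, rfl⟩
    exact ⟨F, hF, e, (heval F e).symm⟩
  · rintro ⟨F, hF, e, rfl⟩
    exact ⟨_, ⟨F, hF, e, rfl⟩, heval F e⟩

theorem tangencyPencilIdeal_le_map_C {p : Ideal (MvPolynomial σ K)}
    (hp : tangencyIdeal I c h ≤ p) (hp' : tangencyIdeal I c h' ≤ p) :
    tangencyPencilIdeal I c h h' ≤ p.map Polynomial.C := by
  rw [tangencyIdeal_le_iff] at hp hp'
  refine sup_le (Ideal.map_mono hp.1) (Ideal.span_le.2 ?_)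
  rintro _ ⟨F, hF, e, rfl⟩
  exact add_mem (Ideal.mem_map_of_mem _ (hp.2 F hF e))
    (Ideal.mul_mem_left _ _ (Ideal.mem_map_of_mem _ (hp'.2 F hF e)))

theorem finite_notMem_minimalPrimes_tangencyIdeal {p : Ideal (MvPolynomial σ K)}
    (hp : p ∈ (tangencyIdeal I c h).minimalPrimes) (hp' : tangencyIdeal I c h' ≤ p) :
    {t : K | p ∉ (tangencyIdeal I c (h + t • h')).minimalPrimes}.Finite := by
  simp only [← map_evalRingHom_tangencyPencilIdeal]
  refine finite_notMem_minimalPrimes_map_evalRingHom (a := algebraMap K _ 0)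
    (tangencyPencilIdeal_le_map_C hp.1.2 hp') ?_
  rwa [map_evalRingHom_tangencyPencilIdeal, zero_smul, add_zero]

end TangencyIdeal

section Contact

open MvPolynomial

variable {r : ℕ} {X Z : Set (PSpace r)} {P : PSpace r} {h h' : Fin (r + 1) → ℂ}

/-- The hyperplane with equation `h` is tangent to `X`, at the smooth points of `X`, along an
irreducible closed subvariety of positive dimension through `P`. -/
def HasContactThrough (X : Set (PSpace r)) (P : PSpace r) (h : Fin (r + 1) → ℂ) : Prop :=
  ∃ Z : Set (PSpace r), IsClosed Z ∧ IsIrreducible Z ∧ Z ⊆ X ∧ P ∈ Z ∧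
    0 < topologicalKrullDim Z ∧ ∀ Q ∈ Z, Q ∈ smoothLocus X → ∀ v ∈ tangentSpace X Q, h ⬝ᵥ v = 0

theorem tangencyIdeal_coneIdeal_le_coneIdeal_iff (hX : IsClosed X) (hirr : IsIrreducible X)
    (hP : P ∈ smoothLocus X) (hZ : IsIrreducible Z) (hPZ : P ∈ Z) :
    tangencyIdeal (coneIdeal X) (Module.finrank ℂ (conormalSpace (coneIdeal X) P.rep)) h ≤
        coneIdeal Z ↔
      Z ⊆ X ∧ ∀ Q ∈ Z, Q ∈ smoothLocus X → ∀ v ∈ tangentSpace X Q, h ⬝ᵥ v = 0 := by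
  rw [tangencyIdeal_le_iff, coneIdeal_le_coneIdeal_iff hX]
  refine and_congr_right fun hZX => ?_
  have hiff : ∀ Q ∈ smoothLocus X, (∀ v ∈ tangentSpace X Q, h ⬝ᵥ v = 0) ↔ _ := fun Q hQ =>
    mem_conormalSpace_coneIdeal_iff.symm.trans <|
      mem_conormalSpace_iff_jacobianMinor (isHomogeneous_coneIdeal X)
        ((mem_smoothLocus_iff_finrank_conormalSpace_eq hP).1 hQ).2
  constructor
  · intro hmem Q hQZ hQ
    rw [hiff Q hQ]
    exact fun F hF e => eval_rep_of_mem_coneIdeal (hmem F hF e) hQZ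
  · intro htan F hF e
    obtain ⟨d, hd⟩ := exists_isHomogeneous_jacobianMinor_cons_linearForm (h := h) hF e
    rw [mem_coneIdeal_iff_forall_mem_smoothLocus hX hirr hP hZ hZX hPZ hd]
    exact fun Q hQZ hQ => (hiff Q hQ).1 (htan Q hQZ hQ) F hF e

theorem tangencyIdeal_coneIdeal_le_coneIdeal_singleton (hX : IsClosed X) (hirr : IsIrreducible X)
    (hP : P ∈ smoothLocus X) (hh : ∀ v ∈ tangentSpace X P, h ⬝ᵥ v = 0) :
    tangencyIdeal (coneIdeal X) (Module.finrank ℂ (conormalSpace (coneIdeal X) P.rep)) h ≤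
      coneIdeal {P} := by
  rw [tangencyIdeal_coneIdeal_le_coneIdeal_iff hX hirr hP isIrreducible_singleton rfl,
    Set.singleton_subset_iff]
  refine ⟨hP.1, ?_⟩
  rintro _ rfl _
  exact hh

theorem exists_isClosed_isIrreducible_of_notMem_minimalPrimes
    {I : Ideal (MvPolynomial (Fin (r + 1)) ℂ)}
    (hI : I.IsHomogeneous (homogeneousSubmodule (Fin (r + 1)) ℂ)) (hIP : I ≤ coneIdeal {P})
    (hP : coneIdeal {P} ∉ I.minimalPrimes) :
    ∃ Z : Set (PSpace r), IsClosed Z ∧ IsIrreducible Z ∧ P ∈ Z ∧ I ≤ coneIdeal Z ∧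
      coneIdeal Z < coneIdeal {P} := by
  have hPprime : (coneIdeal {P}).IsPrime := isPrime_coneIdeal_iff.2 isIrreducible_singleton
  obtain ⟨q, ⟨hq, hIq⟩, hqP⟩ : ∃ q : Ideal (MvPolynomial (Fin (r + 1)) ℂ),
      (q.IsPrime ∧ I ≤ q) ∧ q < coneIdeal {P} := by
    by_contra! hmin
    exact hP ⟨⟨hPprime, hIP⟩, fun q hq hqP => (eq_of_le_of_not_lt hqP (hmin q hq)).ge⟩
  let core := q.homogeneousCore (homogeneousSubmodule (Fin (r + 1)) ℂ)
  have hcore : core.toIdeal.IsPrime := hq.homogeneousCore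
  have hcoreP : core.toIdeal < coneIdeal {P} := (Ideal.toIdeal_homogeneousCore_le _ q).trans_lt hqP
  have hZ : coneIdeal (zeroSet (core.toIdeal : Set (MvPolynomial (Fin (r + 1)) ℂ))) =
      core.toIdeal :=
    coneIdeal_zeroSet_of_isPrime core.isHomogeneous fun hle =>
      (hcoreP.trans (coneIdeal_lt_vanishingIdeal_zero (Set.singleton_nonempty P))).not_ge hle
  refine ⟨zeroSet core.toIdeal, isClosed_zeroSet_ideal core.isHomogeneous, ?_,
    (mem_zeroSet_iff_le_coneIdeal core.isHomogeneous).2 hcoreP.le, ?_, hZ.trans_lt hcoreP⟩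
  · rwa [← isPrime_coneIdeal_iff, hZ]
  · rw [hZ, ← hI.toIdeal_homogeneousCore_eq_self]
    exact Ideal.homogeneousCore_mono _ hIq

theorem hasContactThrough_iff_notMem_minimalPrimes (hX : IsClosed X) (hirr : IsIrreducible X)
    (hP : P ∈ smoothLocus X) (hh : ∀ v ∈ tangentSpace X P, h ⬝ᵥ v = 0) :
    HasContactThrough X P h ↔ coneIdeal {P} ∉ (tangencyIdeal (coneIdeal X)
      (Module.finrank ℂ (conormalSpace (coneIdeal X) P.rep)) h).minimalPrimes := by
  constructor
  · rintro ⟨Z, hZ, hZirr, hZX, hPZ, hdim, htan⟩ hmin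
    rw [topologicalKrullDim_pos_iff_coneIdeal_lt hZ hZirr hPZ] at hdim
    exact hdim.not_ge (hmin.2 ⟨isPrime_coneIdeal_iff.2 hZirr,
      (tangencyIdeal_coneIdeal_le_coneIdeal_iff hX hirr hP hZirr hPZ).2 ⟨hZX, htan⟩⟩ hdim.le)
  · intro hmin
    obtain ⟨Z, hZ, hZirr, hPZ, hle, hlt⟩ := exists_isClosed_isIrreducible_of_notMem_minimalPrimes
      (isHomogeneous_tangencyIdeal (isHomogeneous_coneIdeal X))
      (tangencyIdeal_coneIdeal_le_coneIdeal_singleton hX hirr hP hh) hmin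
    obtain ⟨hZX, htan⟩ := (tangencyIdeal_coneIdeal_le_coneIdeal_iff hX hirr hP hZirr hPZ).1 hle
    exact ⟨Z, hZ, hZirr, hZX, hPZ,
      (topologicalKrullDim_pos_iff_coneIdeal_lt hZ hZirr hPZ).2 hlt, htan⟩

theorem hasContactThrough_of_infinite_pencil (hX : IsClosed X) (hirr : IsIrreducible X)
    (hP : P ∈ smoothLocus X) (hh : ∀ v ∈ tangentSpace X P, h ⬝ᵥ v = 0)
    (hh' : ∀ v ∈ tangentSpace X P, h' ⬝ᵥ v = 0)
    (hinf : {t : ℂ | HasContactThrough X P (h + t • h')}.Infinite) : HasContactThrough X P h := by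
  rw [hasContactThrough_iff_notMem_minimalPrimes hX hirr hP hh]
  intro hmin
  refine hinf ((finite_notMem_minimalPrimes_tangencyIdeal hmin
    (tangencyIdeal_coneIdeal_le_coneIdeal_singleton hX hirr hP hh')).subset fun t ht => ?_)
  refine (hasContactThrough_iff_notMem_minimalPrimes hX hirr hP fun v hv => ?_).1 ht
  rw [add_dotProduct, smul_dotProduct, hh v hv, hh' v hv, smul_zero, add_zero]

end Contact

section Pencil

open MvPolynomial

theorem finite_setOf_eval_add_smul_eq_zero {σ K : Type*} [Field K] {f : MvPolynomial σ K}
    {x y : σ → K} {s : K} (hs : eval (x + s • y) f ≠ 0) :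
    {t : K | eval (x + t • y) f = 0}.Finite := by
  let line : σ → Polynomial K := fun i => Polynomial.C (x i) + Polynomial.X * Polynomial.C (y i)
  have hline : ∀ t, (aeval line f).eval t = eval (x + t • y) f := fun t => by
    have hcomp : (Polynomial.aeval t).comp (aeval line) = aeval (x + t • y) :=
      algHom_ext fun i => by simp [line, mul_comm t]
    exact DFunLike.congr_fun hcomp f
  simp only [← hline] at hs ⊢
  exact Polynomial.finite_setOfPred_isRoot fun h0 => hs (by rw [h0, Polynomial.eval_zero])

variable {r : ℕ} {h h' : Fin (r + 1) → ℂ}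

theorem finite_setOf_pencil_notMem {V : Set (PSpace r)} (hV : IsOpen V) {s : ℂ}
    (hs : ∃ h0 : h + s • h' ≠ 0, Projectivization.mk ℂ _ h0 ∈ V) :
    {t : ℂ | ¬∃ h0 : h + t • h' ≠ 0, Projectivization.mk ℂ _ h0 ∈ V}.Finite := by
  obtain ⟨S, hS, hVS⟩ := exists_eq_zeroSet_of_isClosed hV.isClosed_compl
  have hmem : ∀ Q, Q ∈ V ↔ ∃ f ∈ S, eval Q.rep f ≠ 0 := fun Q => by
    rw [← Set.notMem_compl_iff, hVS]
    simp only [zeroSet, Set.mem_ofPred_eq, not_forall, exists_prop, ne_eq]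
  obtain ⟨hs0, hsV⟩ := hs
  obtain ⟨f, hf, hfs⟩ := (hmem _).1 hsV
  obtain ⟨d, hd⟩ := hS f hf
  obtain ⟨j, hj⟩ := Function.ne_iff.1 hs0
  rw [ne_eq, eval_mk_rep_eq_zero_iff hd] at hfs
  have hjs : eval (h + s • h') (X j) ≠ 0 := by rwa [eval_X]
  refine ((finite_setOf_eval_add_smul_eq_zero hfs).union
    (finite_setOf_eval_add_smul_eq_zero hjs)).subset fun t ht => ?_
  by_contra hne
  obtain ⟨hft, hjt⟩ := not_or.1 hne
  have h0 : h + t • h' ≠ 0 := fun h0 => hjt (by rw [Set.mem_ofPred_eq, h0, eval_X, Pi.zero_apply])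
  exact ht ⟨h0, (hmem _).2 ⟨f, hf, (eval_mk_rep_eq_zero_iff hd h0).not.2 hft⟩⟩

end Pencil

section WeaklyDefective

open MvPolynomial

variable {r m n : ℕ} {X : Set (PSpace r)} {P : Fin n → PSpace r}

theorem le_hyperplane_mk_iff {W : Submodule ℂ (Fin (r + 1) → ℂ)} {h : Fin (r + 1) → ℂ}
    (hh : h ≠ 0) : W ≤ hyperplane (.mk ℂ h hh) ↔ ∀ v ∈ W, h ⬝ᵥ v = 0 := by
  obtain ⟨a, ha⟩ := Projectivization.exists_smul_eq_mk_rep ℂ h hh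
  refine forall₂_congr fun v _ => ?_
  change (Projectivization.mk ℂ h hh).rep ⬝ᵥ v = 0 ↔ _
  rw [← ha, Units.smul_def, smul_dotProduct, smul_eq_zero_iff_right a.ne_zero]

theorem hasPositiveDimContact_mk_iff {h : Fin (r + 1) → ℂ} (hh : h ≠ 0) :
    HasPositiveDimContact X P (.mk ℂ h hh) ↔ ∃ i, HasContactThrough X (P i) h := by
  simp only [HasPositiveDimContact, HasContactThrough, le_hyperplane_mk_iff]
  constructor
  · rintro ⟨Z, hZ, hirr, hZX, ⟨i, hi⟩, hdim, htan⟩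
    exact ⟨i, Z, hZ, hirr, hZX, hi, hdim, htan⟩
  · rintro ⟨i, Z, hZ, hirr, hZX, hi, hdim, htan⟩
    exact ⟨Z, hZ, hirr, hZX, ⟨i, hi⟩, hdim, htan⟩

theorem tangentSpace_le_tangentSpan (i : Fin n) : tangentSpace X (P i) ≤ tangentSpan X P :=
  le_iSup (fun i => tangentSpace X (P i)) i

theorem hasPositiveDimContact_of_isOpen (hX : IsClosed X) (hirr : IsIrreducible X)
    (hP : ∀ i, P i ∈ smoothLocus X) {V : Set (PSpace r)} (hV : IsOpen V)
    (hne : ∃ h ∈ V, tangentSpan X P ≤ hyperplane h)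
    (hcontact : ∀ h ∈ V, tangentSpan X P ≤ hyperplane h → HasPositiveDimContact X P h)
    {h₀ : PSpace r} (hh₀ : tangentSpan X P ≤ hyperplane h₀) : HasPositiveDimContact X P h₀ := by
  obtain ⟨h₁, h₁V, hh₁⟩ := hne
  let u := h₁.rep - h₀.rep
  have hu : ∀ v ∈ tangentSpan X P, u ⬝ᵥ v = 0 := fun v hv => by
    rw [sub_dotProduct, sub_eq_zero]
    exact (hh₁ hv).trans (hh₀ hv).symm
  have h₀u : h₀.rep + (1 : ℂ) • u = h₁.rep := by rw [one_smul, add_sub_cancel]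
  have hfin := finite_setOf_pencil_notMem hV (h := h₀.rep) (h' := u) (s := 1)
    ⟨h₀u ▸ h₁.rep_nonzero, by simpa only [h₀u, Projectivization.mk_rep]⟩
  have hsub : {t : ℂ | ¬∃ h0 : h₀.rep + t • u ≠ 0, Projectivization.mk ℂ _ h0 ∈ V}ᶜ ⊆
      ⋃ i, {t : ℂ | HasContactThrough X (P i) (h₀.rep + t • u)} := fun t ht => by
    obtain ⟨h0, htV⟩ := not_not.1 ht
    refine Set.mem_iUnion.2 <| (hasPositiveDimContact_mk_iff h0).1 <| hcontact _ htV <|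
      (le_hyperplane_mk_iff h0).2 fun v hv => ?_
    rw [add_dotProduct, smul_dotProduct, hu v hv, smul_zero, add_zero]
    exact hh₀ hv
  obtain ⟨i, hi⟩ : ∃ i, {t : ℂ | HasContactThrough X (P i) (h₀.rep + t • u)}.Infinite := by
    by_contra! hc
    exact hfin.infinite_compl ((Set.finite_iUnion hc).subset hsub)
  rw [← h₀.mk_rep, hasPositiveDimContact_mk_iff]
  exact ⟨i, hasContactThrough_of_infinite_pencil hX hirr (hP i)
    (fun v hv => hh₀ (tangentSpace_le_tangentSpan i hv))
    (fun v hv => hu v (tangentSpace_le_tangentSpan i hv)) hi⟩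

theorem finrank_iSup_le_sum_finrank {K V ι : Type*} [Field K] [AddCommGroup V] [Module K V]
    [FiniteDimensional K V] [Fintype ι] (W : ι → Submodule K V) :
    Module.finrank K (⨆ i, W i : Submodule K V) ≤ ∑ i, Module.finrank K (W i) := by
  classical
  rw [Submodule.iSup_eq_range_dfinsupp_lsum]
  exact (LinearMap.finrank_range_le _).trans (Module.finrank_directSum K fun i => W i).le

theorem exists_le_hyperplane_of_lt_top {W : Submodule ℂ (Fin (r + 1) → ℂ)} (hW : W < ⊤) :
    ∃ h, W ≤ hyperplane h := by
  obtain ⟨φ, hφ, hle⟩ := Submodule.exists_le_ker_of_lt_top W hW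
  obtain ⟨w, rfl⟩ := (dotProductEquiv ℂ (Fin (r + 1))).surjective φ
  have hw : w ≠ 0 := by rwa [ne_eq, LinearEquiv.map_eq_zero_iff] at hφ
  exact ⟨.mk ℂ w hw, (le_hyperplane_mk_iff hw).2 hle⟩

theorem tangentSpan_lt_top (hdim : topologicalKrullDim X = m) (hP : ∀ i, P i ∈ smoothLocus X)
    (hn : n * (m + 1) < r + 1) : tangentSpan X P < ⊤ := by
  have hfinrank : ∀ i, Module.finrank ℂ (tangentSpace X (P i)) = m + 1 := fun i => by
    have hi := (hP i).2
    rw [hdim] at hi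
    exact_mod_cast hi
  refine Submodule.lt_top_of_finrank_lt_finrank ?_
  calc Module.finrank ℂ (tangentSpan X P)
      ≤ ∑ i, Module.finrank ℂ (tangentSpace X (P i)) := finrank_iSup_le_sum_finrank _
    _ = n * (m + 1) := by simp [hfinrank]
    _ < Module.finrank ℂ (Fin (r + 1) → ℂ) := by rwa [Module.finrank_fin_fun]

theorem isWeightedHomogeneous_rename {σ τ R M N : Type*} [CommSemiring R] [AddCommMonoid M]
    [AddCommMonoid N] {w : σ → M} {w' : τ → N} {f : MvPolynomial σ R} {d : M}
    (hf : f.IsWeightedHomogeneous w d) {φ : σ → τ} (ψ : M →+ N) (hψ : ∀ i, w' (φ i) = ψ (w i)) :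
    (rename φ f).IsWeightedHomogeneous w' (ψ d) := fun u hu => by
  obtain ⟨v, rfl, hv⟩ := coeff_rename_ne_zero _ _ _ hu
  rw [← hf hv, Finsupp.weight_apply, Finsupp.weight_apply, map_finsuppSum,
    Finsupp.sum_mapDomain_index (by simp only [zero_smul, implies_true])
      (by simp only [add_smul, implies_true])]
  simp only [hψ, map_nsmul]

theorem isZariskiOpen_preimage_comp {U : Set (Fin n → PSpace r)} (hU : IsZariskiOpen U)
    {n' : ℕ} (e : Fin n → Fin n') :
    IsZariskiOpen {P : Fin n' → PSpace r | P ∘ e ∈ U} := by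
  obtain ⟨S, hS, rfl⟩ := hU
  let ψ : (Fin n → ℕ) →+ (Fin n' → ℕ) :=
    ∑ i, (AddMonoidHom.single (fun _ => ℕ) (e i)).comp (Pi.evalAddMonoidHom _ i)
  have hψ : ∀ i, Pi.single (e i) 1 = ψ (Pi.single i 1) := fun i => by
    simp only [ψ, AddMonoidHom.finsetSum_apply, AddMonoidHom.comp_apply, Pi.evalAddMonoidHom_apply,
      AddMonoidHom.single_apply]
    rw [Finset.sum_eq_single i, Pi.single_eq_same]
    · intro j _ hj
      rw [Pi.single_eq_of_ne hj, Pi.single_zero]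
    · simp
  refine ⟨rename (Prod.map e id) '' S, ?_, ?_⟩
  · rintro _ ⟨f, hf, rfl⟩
    obtain ⟨d, hd⟩ := hS f hf
    exact ⟨ψ d, isWeightedHomogeneous_rename hd ψ fun ij => hψ ij.1⟩
  · ext P
    simp only [Set.mem_ofPred_eq, Set.exists_mem_image, eval_rename]
    rfl

theorem isWeaklyDefective_succ {k : ℕ} (hX : IsClosed X) (hirr : IsIrreducible X)
    (hdim : topologicalKrullDim X = m) (hr : (k + 1) * m + m + (k + 1) < r)
    (hk : IsWeaklyDefective X k) : IsWeaklyDefective X (k + 1) := by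
  obtain ⟨U, hU, ⟨P₀, hP₀U, hP₀⟩, hcontact⟩ := hk
  refine ⟨_, isZariskiOpen_preimage_comp hU Fin.castSucc, ⟨Fin.snoc P₀ (P₀ 0), ?_, ?_⟩,
    fun P hPU hP => ?_⟩
  · rwa [Set.mem_ofPred_eq, Fin.snoc_comp_castSucc]
  · refine Fin.lastCases ?_ fun i => ?_
    · simpa only [Fin.snoc_last] using hP₀ 0
    · simpa only [Fin.snoc_castSucc] using hP₀ i
  have hinit : ∀ i, (P ∘ Fin.castSucc) i ∈ smoothLocus X := fun i => hP i.castSucc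
  obtain ⟨V, hV, hne, hVcontact⟩ := hcontact _ hPU hinit
  obtain ⟨h₀, hh₀⟩ := exists_le_hyperplane_of_lt_top (tangentSpan_lt_top hdim hP (by linarith))
  refine ⟨Set.univ, isOpen_univ, ⟨h₀, Set.mem_univ _, hh₀⟩, fun h _ hh => ?_⟩
  have hle : tangentSpan X (P ∘ Fin.castSucc) ≤ tangentSpan X P :=
    iSup_le fun i => tangentSpace_le_tangentSpan i.castSucc
  obtain ⟨Z, hZ, hZirr, hZX, ⟨i, hi⟩, hZcontact⟩ :=
    hasPositiveDimContact_of_isOpen hX hirr hinit hV hne hVcontact (hle.trans hh)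
  exact ⟨Z, hZ, hZirr, hZX, ⟨i.castSucc, hi⟩, hZcontact⟩

end WeaklyDefective

end WeakDefect

theorem mainTheorem5_general {r m k : ℕ} {X : Set (WeakDefect.PSpace r)} (hX : IsClosed X)
    (hirr : IsIrreducible X) (hdim : topologicalKrullDim X = m) (hr : k * m + m + k < r)
    (hnot : ¬ WeakDefect.IsWeaklyDefective X k) :
    ∀ j ≤ k, ¬ WeakDefect.IsWeaklyDefective X j := by
  intro j hjk hj
  refine hnot ?_
  clear hnot
  induction k, hjk using Nat.le_induction with
  | base => exact hj
  | succ k _ ih => exact WeakDefect.isWeaklyDefective_succ hX hirr hdim hr (ih (by linarith))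

theorem mainTheorem5 (r m k : ℕ) (X : Set (WeakDefect.PSpace r))
    (hX : WeakDefect.IsNondegenerateVariety X m) (hk : 1 ≤ k)
    (hr : k * m + m + k < r)
    (hnot : ¬ WeakDefect.IsWeaklyDefective X k) :
    ¬ WeakDefect.IsWeaklyDefective X (k - 1) ∧
      ∀ j ≤ k, ¬ WeakDefect.IsWeaklyDefective X j := by
  have key := mainTheorem5_general hX.isClosed hX.isIrreducible hX.dim_eq hr hnot
  exact ⟨key (k - 1) (Nat.sub_le k 1), key⟩
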